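/- Let $a\ge 3$ be an integer, let $\rho$ be a root of $x^3+(a-1)x^2-ax-1$, and let $K=\mathbb{Q}(\rho)$, which is a totally real cubic field. An element of $K$ is called totally positive if it is positive under every embedding $K\to\mathbb{R}$. Let $\mathbb{Z}[\rho]^{\vee,+}$ be the set of totally positive elements of the codifferent $$\mathbb{Z}[\rho]^{\vee}=\{\delta\in K : \operatorname{Tr}_{K/\mathbb{Q}}(\beta\delta)\in\mathbb{Z}\text{ for all }\beta\in\mathbb{Z}[\rho]\}.$$ A totally positive element $\alpha\in\mathbb{Z}[\rho]$ is called indecomposable if it is not the sum of two totally positive elements of $\mathbb{Z}[\rho]$. If $\alpha\in\mathbb{Z}[\rho]$ is indecomposable and is not a unit of $\mathbb{Z}[\rho]$, then $$\min_{\delta\in\mathbb{Z}[\rho]^{\vee,+}}\operatorname{Tr}_{K/\mathbb{Q}}(\alpha\delta)=2,$$ and in particular the minimum is attained. -/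

import Mathlib

/-- An element of a (totally real) number field is totally positive if it is positive under every
embedding of the field into the real numbers. -/
def TotallyPositive {K : Type*} [Field K] (x : K) : Prop :=
  ∀ σ : K →+* ℝ, 0 < σ x

/-- An element of an order `O` in `K` is (additively) indecomposable if it is totally positive and
is not the sum of two totally positive elements of `O`. -/
def IndecomposableInOrder {K : Type*} [Field K] (O : Subalgebra ℤ K) (α : O) : Prop :=
  TotallyPositive (α : K) ∧
    ¬ ∃ β γ : O, TotallyPositive (β : K) ∧ TotallyPositive (γ : K) ∧ α = β + γ

/-- The codifferent of an order `O` in `K`: the dual of `O` under the trace form of `K` over `ℚ`,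
i.e. all `δ` in `K` such that `Tr (δ * β)` is an integer for all `β` in `O`. -/
noncomputable def codifferent {K : Type*} [Field K] [NumberField K] (O : Subalgebra ℤ K) :
    Submodule ℤ K :=
  (Algebra.traceForm ℚ K).dualSubmodule (Subalgebra.toSubmodule O)

theorem mem_codifferent_iff {K : Type*} [Field K] [NumberField K] (O : Subalgebra ℤ K) (δ : K) :
    δ ∈ codifferent O ↔ ∀ β : K, β ∈ O → ∃ n : ℤ, Algebra.trace ℚ K (β * δ) = (n : ℚ) := by
  simp [codifferent, LinearMap.BilinForm.mem_dualSubmodule, Algebra.traceForm_apply,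
    Submodule.mem_one, mul_comm, eq_comm]

/-!
Write `f = x (x - 1) (x + a) - 1`, `ε = ρ ^ 2` and `η = ρ ^ 2 - ρ`; both `ε` and `η = (ρ + a)⁻¹` are
totally positive units. The two simplicial cones spanned by `1, ε, η` and by `1, η⁻¹, ε⁻¹` have
translates under the group of totally positive units that cover all totally positive elements of
`ℤ[ρ]`. Instead of a topological argument for this, the proof uses duality. The elements `dualOne`
and `dualTwo`, which are `(1 + ρ⁻¹) / f' ρ` and `(ρ ^ 2 - a⁻¹) / f' ρ`, are totally positive, and
their trace pairings take the value `1` on the generators of the first and of the second cone,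
respectively. Given a totally positive `α`, choose a totally positive unit `v` and one of these two
elements `d` such that `Tr (α v d)` is smallest (`exists_minimal_trace`). The difference of the
functionals belonging to two adjacent cones vanishes on their common face, so comparison with the
three neighbours says precisely that the three coordinates of `α v` in the cone of `d` are
nonnegative (`mem_cone_one`, `mem_cone_two`).

If `α` is indecomposable and not a unit, these coordinates are less than `1` (`coeff_lt_one`).
The first cone is unimodular and contains no such points except `0`, whereas in the second cone they
are the points `t + (1 - t) η⁻¹ + t ε⁻¹` with `0 < t < 1` (`exists_normal_form`).

For a totally positive `δ` in the codifferent and a totally positive unit `u`, the trace of `u δ` is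
a positive integer, because `K` is totally real. Hence `Tr (α δ) ≥ t + (1 - t) + t > 1`, so that
`Tr (α δ) ≥ 2`. The pairing with `ε * dualOne` takes the values `1`, `2`, `1` at `1`, `η⁻¹`, `ε⁻¹`,
so `δ = v ε * dualOne` gives exactly `t + 2 (1 - t) + t = 2`. The traces are computed by Euler's
formula `trace_pow_div`.
-/

/-! ### Roots of the cubic -/

/-- A real root of `x (x - 1) (x + a) = 1`, where `a ≥ 3`, lies in `(1, ∞)`, in `(-1, 0)` or in
`(-a, -1)`; these bounds determine all the signs needed below. -/
theorem root_cases {a x : ℝ} (ha : 3 ≤ a) (h : x * (x - 1) * (x + a) = 1) :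
    0 < x + a ∧ (1 < x ∨ (-1 < x ∧ x < 0 ∧ x ^ 2 < 1 / a) ∨ x < -1) := by
  have hxa : 0 < x + a := by
    by_contra! hc
    have h1 : 0 ≤ x * (x - 1) := by nlinarith
    nlinarith [mul_nonneg h1 (sub_nonneg.2 hc)]
  refine ⟨hxa, ?_⟩
  have h2 : 0 < x * (x - 1) := by
    by_contra! hc
    nlinarith [mul_nonneg (sub_nonneg.2 hc) hxa.le]
  rcases lt_or_ge 1 x with h1 | h1
  · exact Or.inl h1
  right
  have h0 : x < 0 := by
    by_contra! hc
    nlinarith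
  rcases lt_or_ge x (-1) with h3 | h3
  · exact Or.inr h3
  left
  have hne : x ≠ -1 := by
    rintro rfl
    linarith
  have h4 : -1 < x := lt_of_le_of_ne h3 hne.symm
  refine ⟨h4, h0, ?_⟩
  rw [lt_div_iff₀ (by linarith)]
  by_contra! hc
  nlinarith [mul_pos (neg_pos.2 h0) (by linarith : (0:ℝ) < 1 + x),
    mul_nonneg (sq_nonneg x) (by linarith : (0:ℝ) ≤ 1 + x),
    mul_nonneg (by linarith : (0:ℝ) ≤ a - 3) (by linarith : (0:ℝ) ≤ -x)]

/-- At every real root `x` of `f = x (x - 1) (x + a) - 1`, the numbers `(1 + x⁻¹) / f' x` and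
`(x ^ 2 - a⁻¹) / f' x` are positive. -/
theorem root_signs {a x : ℝ} (ha : 3 ≤ a) (h : x * (x - 1) * (x + a) = 1) :
    0 < (x ^ 2 + (a - 1) * x - a + 1) / (3 * x ^ 2 + 2 * (a - 1) * x - a) ∧
    0 < (x ^ 2 - 1 / a) / (3 * x ^ 2 + 2 * (a - 1) * x - a) := by
  obtain ⟨hxa, hc⟩ := root_cases ha h
  have hx0 : x ≠ 0 := by rintro rfl; simp at h
  have hinv : x ^ 2 + (a - 1) * x - a + 1 = (x + 1) / x := by
    rw [eq_div_iff hx0]; linarith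
  have ha1 : 1 / a ≤ 1 / 3 := one_div_le_one_div_of_le (by norm_num) ha
  rw [hinv]
  rcases hc with h1 | ⟨h1, h2, h3⟩ | h1
  · have hd : 0 < 3 * x ^ 2 + 2 * (a - 1) * x - a := by nlinarith
    exact ⟨by positivity, div_pos (by nlinarith) hd⟩
  · have hd : 3 * x ^ 2 + 2 * (a - 1) * x - a < 0 := by nlinarith
    exact ⟨div_pos_of_neg_of_neg (div_neg_of_pos_of_neg (by linarith) h2) hd,
      div_pos_of_neg_of_neg (by linarith) hd⟩
  · have hp : 2 < x ^ 2 - x := by nlinarith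
    -- the logarithmic derivative `1 / x + 1 / (x - 1) + 1 / (x + a)`, multiplied by `x (x - 1)`
    have hd : 0 < 3 * x ^ 2 + 2 * (a - 1) * x - a := by
      have e1 : (x ^ 2 - x) * (x + a) = 1 := by linarith
      have e2 : (3 * x ^ 2 + 2 * (a - 1) * x - a) * (x ^ 2 - x) =
          (x ^ 2 - x) ^ 2 + (2 * x - 1) := by linear_combination (2 * x - 1) * e1
      by_contra! hcon
      nlinarith [mul_nonneg (sub_nonneg.2 hcon) (by linarith : 0 ≤ x ^ 2 - x)]
    exact ⟨div_pos (div_pos_of_neg_of_neg (by linarith) (by linarith)) hd,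
      div_pos (by nlinarith) hd⟩

/-- All complex roots of the cubic are real, because the intermediate value theorem gives three
distinct real ones. -/
theorem complex_root_real {a : ℝ} (ha : 3 ≤ a) {z : ℂ} (h : z * (z - 1) * (z + a) = 1) :
    ∃ x : ℝ, z = x := by
  have hcont : Continuous fun x : ℝ => x * (x - 1) * (x + a) := by fun_prop
  have e1 : ∃ x : ℝ, 1 < x ∧ x * (x - 1) * (x + a) = 1 := by
    obtain ⟨x, hx, hx'⟩ := intermediate_value_Icc (by norm_num : (1:ℝ) ≤ 2) hcont.continuousOn
      (show (1:ℝ) ∈ _ by constructor <;> norm_num; linarith)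
    have hx' : x * (x - 1) * (x + a) = 1 := hx'
    refine ⟨x, lt_of_le_of_ne hx.1 ?_, hx'⟩
    rintro rfl; norm_num at hx'
  have e2 : ∃ x : ℝ, -1 < x ∧ x < 0 ∧ x * (x - 1) * (x + a) = 1 := by
    obtain ⟨x, hx, hx'⟩ := intermediate_value_Icc' (by norm_num : (-1:ℝ) ≤ 0) hcont.continuousOn
      (show (1:ℝ) ∈ _ by constructor <;> norm_num; linarith)
    have hx' : x * (x - 1) * (x + a) = 1 := hx'
    refine ⟨x, lt_of_le_of_ne hx.1 ?_, lt_of_le_of_ne hx.2 ?_, hx'⟩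
    · rintro rfl; linarith
    · rintro rfl; norm_num at hx'
  have e3 : ∃ x : ℝ, x < -1 ∧ x * (x - 1) * (x + a) = 1 := by
    obtain ⟨x, hx, hx'⟩ := intermediate_value_Icc (by linarith : -a ≤ -1) hcont.continuousOn
      (show (1:ℝ) ∈ _ by constructor <;> norm_num; linarith)
    have hx' : x * (x - 1) * (x + a) = 1 := hx'
    refine ⟨x, lt_of_le_of_ne hx.2 ?_, hx'⟩
    rintro rfl; linarith
  obtain ⟨x, hx, fx⟩ := e1
  obtain ⟨y, hy, hy', fy⟩ := e2
  obtain ⟨w, hw, fw⟩ := e3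
  -- divided differences of the cubic
  have q1 : y ^ 2 + y * x + x ^ 2 + (a - 1) * (y + x) - a = 0 := by
    have : y - x ≠ 0 := by linarith
    apply mul_left_cancel₀ this
    linear_combination fy - fx
  have q2 : w ^ 2 + w * x + x ^ 2 + (a - 1) * (w + x) - a = 0 := by
    have : w - x ≠ 0 := by linarith
    apply mul_left_cancel₀ this
    linear_combination fw - fx
  have q3 : w + x + y + (a - 1) = 0 := by
    have : w - y ≠ 0 := by linarith
    apply mul_left_cancel₀ this
    linear_combination q2 - q1
  have q1' : (y ^ 2 + y * x + x ^ 2 + (a - 1) * (y + x) - a : ℂ) = 0 := by exact_mod_cast q1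
  have q3' : (w + x + y + (a - 1) : ℂ) = 0 := by exact_mod_cast q3
  have fx' : (x * (x - 1) * (x + a) : ℂ) = 1 := by exact_mod_cast fx
  by_cases hzx : z = x
  · exact ⟨x, hzx⟩
  by_cases hzy : z = y
  · exact ⟨y, hzy⟩
  refine ⟨w, ?_⟩
  have r1 : z ^ 2 + z * x + x ^ 2 + (a - 1) * (z + x) - a = 0 := by
    apply mul_left_cancel₀ (sub_ne_zero.2 hzx)
    linear_combination h - fx'
  have r2 : z + x + y + (a - 1) = 0 := by
    apply mul_left_cancel₀ (sub_ne_zero.2 hzy)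
    linear_combination r1 - q1'
  linear_combination r2 - q3'

/-! ### The minimal polynomial, the trace form and total reality -/

section
open Polynomial

theorem minpoly_eq_cubic {K : Type*} [Field K] [NumberField K] {a : ℤ} (ha : 3 ≤ a) {ρ : K}
    (hρ : ρ ^ 3 + ((a : K) - 1) * ρ ^ 2 - (a : K) * ρ - 1 = 0) :
    minpoly ℚ ρ = X ^ 3 + C ((a : ℚ) - 1) * X ^ 2 - C (a : ℚ) * X - 1 := by
  have hform : (X ^ 3 + C ((a : ℚ) - 1) * X ^ 2 - C (a : ℚ) * X - 1 : ℚ[X]) =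
      C 1 * X ^ 3 + C ((a : ℚ) - 1) * X ^ 2 + C (-(a : ℚ)) * X + C (-1) := by
    simp only [map_neg, map_one]; ring
  have hdeg : (X ^ 3 + C ((a : ℚ) - 1) * X ^ 2 - C (a : ℚ) * X - 1 : ℚ[X]).natDegree = 3 := by
    rw [hform]; exact natDegree_cubic one_ne_zero
  have hmonic : (X ^ 3 + C ((a : ℚ) - 1) * X ^ 2 - C (a : ℚ) * X - 1 : ℚ[X]).Monic := by
    rw [hform]; exact leadingCoeff_cubic one_ne_zero
  symm
  -- a rational root would be an integer dividing `1`
  refine minpoly.eq_of_irreducible_of_monic ?_ ?_ hmonic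
  · rw [hmonic.irreducible_iff_roots_eq_zero_of_degree_le_three (by omega) (by omega)]
    refine Multiset.eq_zero_of_forall_notMem fun q hq => ?_
    have hq0 : q ^ 3 + ((a : ℚ) - 1) * q ^ 2 - a * q - 1 = 0 := by
      simpa using (mem_roots'.1 hq).2
    have hint : IsIntegral ℤ q := by
      refine ⟨C 1 * X ^ 3 + C (a - 1) * X ^ 2 + C (-a) * X + C (-1),
        leadingCoeff_cubic one_ne_zero, ?_⟩
      rw [eval₂_add, eval₂_add, eval₂_add, eval₂_mul, eval₂_mul, eval₂_mul, eval₂_pow, eval₂_pow,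
        eval₂_C, eval₂_C, eval₂_C, eval₂_C, eval₂_X]
      push_cast [eq_intCast]
      linear_combination hq0
    obtain ⟨n, rfl⟩ := IsIntegrallyClosed.isIntegral_iff.1 hint
    have hn : n * (n ^ 2 + (a - 1) * n - a) = 1 := by
      have : (n : ℚ) ^ 3 + ((a : ℚ) - 1) * n ^ 2 - a * n - 1 = 0 := by simpa using hq0
      have h2 : (n ^ 3 + (a - 1) * n ^ 2 - a * n - 1 : ℤ) = 0 := by exact_mod_cast this
      linear_combination h2
    rcases Int.isUnit_iff.1 (IsUnit.of_mul_eq_one _ hn) with rfl | rfl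
    · norm_num at hn
    · norm_num at hn; omega
  · simp only [map_sub, map_add, map_mul, map_pow, aeval_X, map_one, map_intCast]
    exact hρ

theorem algebra_adjoin_eq_top {K : Type*} [Field K] [NumberField K] {ρ : K}
    (hK : IntermediateField.adjoin ℚ {ρ} = ⊤) : Algebra.adjoin ℚ {ρ} = ⊤ := by
  rw [← IntermediateField.adjoin_simple_toSubalgebra_of_isAlgebraic
    (Algebra.IsAlgebraic.isAlgebraic ρ), hK, IntermediateField.top_toSubalgebra]

theorem finrank_eq_three {K : Type*} [Field K] [NumberField K] {a : ℤ} (ha : 3 ≤ a) {ρ : K}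
    (hρ : ρ ^ 3 + ((a : K) - 1) * ρ ^ 2 - (a : K) * ρ - 1 = 0)
    (hK : IntermediateField.adjoin ℚ {ρ} = ⊤) : Module.finrank ℚ K = 3 ∧
      (minpoly ℚ ρ).natDegree = 3 := by
  have hdeg : (minpoly ℚ ρ).natDegree = 3 := by
    rw [minpoly_eq_cubic ha hρ]
    compute_degree!
  refine ⟨?_, hdeg⟩
  rw [← hdeg, ← IntermediateField.adjoin.finrank (Algebra.IsIntegral.isIntegral ρ), hK,
    IntermediateField.finrank_top']

/-- Euler's formula for the trace form: `Tr (ρ ^ r / f' ρ)` is the coefficient of `X ^ 2` in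
`X ^ r` for `r ≤ 2`, where `f` is the minimal polynomial of `ρ`. -/
theorem trace_pow_div {K : Type*} [Field K] [NumberField K] {a : ℤ} (ha : 3 ≤ a) {ρ : K}
    (hρ : ρ ^ 3 + ((a : K) - 1) * ρ ^ 2 - (a : K) * ρ - 1 = 0)
    (hK : IntermediateField.adjoin ℚ {ρ} = ⊤) {r : ℕ} (hr : r < 3) :
    Algebra.trace ℚ K (ρ ^ r / (3 * ρ ^ 2 + 2 * (a - 1) * ρ - a)) = if r = 2 then 1 else 0 := by
  obtain ⟨hfin, hdeg⟩ := finrank_eq_three ha hρ hK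
  have hd : aeval ρ (derivative (minpoly ℚ ρ)) = 3 * ρ ^ 2 + 2 * (a - 1) * ρ - a := by
    rw [minpoly_eq_cubic ha hρ]
    simp
    ring
  have hint : IsIntegral ℚ ρ := Algebra.IsIntegral.isIntegral ρ
  have hlead : (minpolyDiv ℚ ρ).coeff 2 = 1 := by
    have h1 := minpolyDiv_monic hint
    have h2 := natDegree_minpolyDiv_succ hint
    rw [hdeg] at h2
    rw [Monic, leadingCoeff, show (minpolyDiv ℚ ρ).natDegree = 2 by omega] at h1
    exact h1
  -- compare the coefficients of `X ^ 2` in `∑ σ, σ (ρ ^ r / f' ρ) • (f / (X - σ ρ)) = X ^ r`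
  have key := congrArg (fun p => p.coeff 2)
    (sum_smul_minpolyDiv_eq_X_pow ℂ (algebra_adjoin_eq_top hK) (r := r) (by rw [hfin]; exact hr))
  simp only [finsetSum_coeff, coeff_map, coeff_smul, hlead, hd, smul_eq_mul, mul_one,
    coeff_X_pow] at key
  have h3 := trace_eq_sum_embeddings (K := ℚ) (L := K) ℂ
    (x := ρ ^ r / (3 * ρ ^ 2 + 2 * (a - 1) * ρ - a))
  apply (algebraMap ℚ ℂ).injective
  rw [h3]
  refine (Eq.trans ?_ key).trans ?_
  · rfl
  · by_cases h : r = 2 <;> simp [h, eq_comm]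

theorem cubic_map {K L : Type*} [Field K] [Field L] {a : ℤ} {ρ : K}
    (hρ : ρ ^ 3 + ((a : K) - 1) * ρ ^ 2 - (a : K) * ρ - 1 = 0) (σ : K →+* L) :
    σ ρ * (σ ρ - 1) * (σ ρ + a) = 1 := by
  have h : ρ * (ρ - 1) * (ρ + a) = 1 := by linear_combination hρ
  simpa using congrArg σ h

/-- `K` is totally real. -/
theorem embedding_isReal {K : Type*} [Field K] [NumberField K] {a : ℤ} (ha : 3 ≤ a) {ρ : K}
    (hρ : ρ ^ 3 + ((a : K) - 1) * ρ ^ 2 - (a : K) * ρ - 1 = 0)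
    (hK : IntermediateField.adjoin ℚ {ρ} = ⊤) (σ : K →+* ℂ) :
    NumberField.ComplexEmbedding.IsReal σ := by
  obtain ⟨x, hx⟩ := complex_root_real (a := (a : ℝ)) (by exact_mod_cast ha)
    (by simpa using cubic_map hρ σ)
  rw [NumberField.ComplexEmbedding.isReal_iff]
  ext y
  have hy : y ∈ IntermediateField.adjoin ℚ {ρ} := hK ▸ IntermediateField.mem_top
  induction hy using IntermediateField.adjoin_induction with
  | mem y hy =>
    rw [Set.mem_singleton_iff] at hy
    simp [NumberField.ComplexEmbedding.conjugate_coe_eq, hy, hx]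
  | algebraMap q => simp
  | add x y _ _ h1 h2 => rw [map_add, map_add, h1, h2]
  | inv x _ h1 => rw [map_inv₀, map_inv₀, h1]
  | mul x y _ _ h1 h2 => rw [map_mul, map_mul, h1, h2]

theorem TotallyPositive.trace_pos {K : Type*} [Field K] [NumberField K] {a : ℤ} (ha : 3 ≤ a)
    {ρ : K} (hρ : ρ ^ 3 + ((a : K) - 1) * ρ ^ 2 - (a : K) * ρ - 1 = 0)
    (hK : IntermediateField.adjoin ℚ {ρ} = ⊤) {x : K} (hx : TotallyPositive x) :
    0 < Algebra.trace ℚ K x := by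
  have h := trace_eq_sum_embeddings (K := ℚ) (L := K) ℂ (x := x)
  have h2 := congrArg Complex.re h
  have h3 : (((Algebra.trace ℚ K x : ℚ) : ℝ)) = ∑ σ : K →ₐ[ℚ] ℂ, (σ x).re := by
    simpa using h2
  have h4 : (0:ℝ) < ∑ σ : K →ₐ[ℚ] ℂ, (σ x).re := by
    apply Finset.sum_pos
    · intro σ _
      have hr := embedding_isReal ha hρ hK (σ : K →+* ℂ)
      have h5 := hr.coe_embedding_apply x
      have h6 := hx hr.embedding
      rw [RingHom.coe_coe] at h5
      rw [← h5, Complex.ofReal_re]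
      exact h6
    · exact ⟨IsAlgClosed.lift, Finset.mem_univ _⟩
  rw [← h3] at h4
  exact_mod_cast h4

theorem TotallyPositive.ne_zero {K : Type*} [Field K] [NumberField K] {a : ℤ} (ha : 3 ≤ a)
    {ρ : K} (hρ : ρ ^ 3 + ((a : K) - 1) * ρ ^ 2 - (a : K) * ρ - 1 = 0)
    (hK : IntermediateField.adjoin ℚ {ρ} = ⊤) {x : K} (hx : TotallyPositive x) : x ≠ 0 := by
  rintro rfl
  simpa using hx.trace_pos ha hρ hK

theorem TotallyPositive.mul {K : Type*} [Field K] {x y : K} (hx : TotallyPositive x)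
    (hy : TotallyPositive y) : TotallyPositive (x * y) := fun σ => by
  rw [map_mul]; exact mul_pos (hx σ) (hy σ)

theorem TotallyPositive.inv {K : Type*} [Field K] {x : K} (hx : TotallyPositive x) :
    TotallyPositive x⁻¹ := fun σ => by
  rw [map_inv₀]; exact inv_pos.2 (hx σ)
end

/-! ### Dual elements and totally positive units -/

section
variable {K : Type*} [Field K]

/-- The totally positive element `(1 + ρ⁻¹) / f' ρ` with `f = x (x - 1) (x + a) - 1`. Its trace
pairing takes the value `1` at the units `1`, `ρ ^ 2` and `ρ ^ 2 - ρ`. -/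
def dualOne (a : ℤ) (ρ : K) : K :=
  (ρ ^ 2 + (a - 1) * ρ - a + 1) / (3 * ρ ^ 2 + 2 * (a - 1) * ρ - a)

/-- The totally positive element `(ρ ^ 2 - a⁻¹) / f' ρ` with `f = x (x - 1) (x + a) - 1`. Its trace
pairing takes the value `1` at the units `1`, `ρ + a` and `ρ⁻¹ ^ 2`. -/
def dualTwo (a : ℤ) (ρ : K) : K :=
  (ρ ^ 2 - 1 / a) / (3 * ρ ^ 2 + 2 * (a - 1) * ρ - a)

/-- Totally positive units of the order `O`, viewed as elements of `K`. -/
def IsTotPosUnit (O : Subalgebra ℤ K) (v : K) : Prop :=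
  v ∈ O ∧ v⁻¹ ∈ O ∧ TotallyPositive v

theorem IsTotPosUnit.mul {O : Subalgebra ℤ K} {v w : K} (hv : IsTotPosUnit O v)
    (hw : IsTotPosUnit O w) : IsTotPosUnit O (v * w) :=
  ⟨mul_mem hv.1 hw.1, by rw [mul_inv]; exact mul_mem hv.2.1 hw.2.1, hv.2.2.mul hw.2.2⟩

theorem IsTotPosUnit.inv {O : Subalgebra ℤ K} {v : K} (hv : IsTotPosUnit O v) :
    IsTotPosUnit O v⁻¹ :=
  ⟨hv.2.1, by rw [inv_inv]; exact hv.1, hv.2.2.inv⟩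

theorem isTotPosUnit_one (O : Subalgebra ℤ K) : IsTotPosUnit O 1 :=
  ⟨one_mem _, by rw [inv_one]; exact one_mem _, fun σ => by simp⟩

variable {a : ℤ} {ρ : K}

theorem totallyPositive_dual (ha : 3 ≤ a)
    (hρ : ρ ^ 3 + ((a : K) - 1) * ρ ^ 2 - (a : K) * ρ - 1 = 0) :
    TotallyPositive (dualOne a ρ) ∧ TotallyPositive (dualTwo a ρ) := by
  have h := fun σ : K →+* ℝ => root_signs (a := (a : ℝ)) (by exact_mod_cast ha) (cubic_map hρ σ)
  exact ⟨fun σ => by simpa [dualOne, map_ofNat σ] using (h σ).1,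
    fun σ => by simpa [dualTwo, map_ofNat σ] using (h σ).2⟩

/-- The elements of `ℤ[ρ]` are integral combinations of `1`, `ρ` and `ρ ^ 2`. -/
theorem exists_coords (hρ : ρ ^ 3 + ((a : K) - 1) * ρ ^ 2 - (a : K) * ρ - 1 = 0) {x : K}
    (hx : x ∈ Algebra.adjoin ℤ {ρ}) : ∃ A B C : ℤ, x = A + B * ρ + C * ρ ^ 2 := by
  induction hx using Algebra.adjoin_induction with
  | mem y hy =>
    rw [Set.mem_singleton_iff] at hy
    exact ⟨0, 1, 0, by simp [hy]⟩
  | algebraMap n => exact ⟨n, 0, 0, by simp⟩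
  | add y z _ _ hy hz =>
    obtain ⟨A, B, C, rfl⟩ := hy
    obtain ⟨A', B', C', rfl⟩ := hz
    exact ⟨A + A', B + B', C + C', by push_cast; ring⟩
  | mul y z _ _ hy hz =>
    obtain ⟨A, B, C, rfl⟩ := hy
    obtain ⟨A', B', C', rfl⟩ := hz
    refine ⟨A * A' + (B * C' + C * B') + C * C' * (1 - a),
      A * B' + B * A' + (B * C' + C * B') * a + C * C' * (a * (1 - a) + 1),
      A * C' + B * B' + C * A' + (B * C' + C * B') * (1 - a) + C * C' * ((1 - a) ^ 2 + a), ?_⟩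
    push_cast
    linear_combination (B * C' + C * B' + C * C' * (ρ + (1 - a)) : K) * hρ

theorem self_mem : ρ ∈ Algebra.adjoin ℤ {ρ} := Algebra.subset_adjoin (Set.mem_singleton ρ)

theorem coords_mem (A B C : ℤ) : (A + B * ρ + C * ρ ^ 2 : K) ∈ Algebra.adjoin ℤ {ρ} :=
  add_mem (add_mem (intCast_mem _ _) (mul_mem (intCast_mem _ _) self_mem))
    (mul_mem (intCast_mem _ _) (pow_mem self_mem _))

theorem ne_zero_of_cubic (hρ : ρ ^ 3 + ((a : K) - 1) * ρ ^ 2 - (a : K) * ρ - 1 = 0) : ρ ≠ 0 := by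
  rintro rfl
  simp at hρ

theorem inv_eq_of_cubic (hρ : ρ ^ 3 + ((a : K) - 1) * ρ ^ 2 - (a : K) * ρ - 1 = 0) :
    ρ⁻¹ = ρ ^ 2 + (a - 1) * ρ - a ∧ (ρ ^ 2 - ρ)⁻¹ = ρ + a :=
  ⟨inv_eq_of_mul_eq_one_right <| by linear_combination hρ,
    inv_eq_of_mul_eq_one_right <| by linear_combination hρ⟩

theorem isTotPosUnit_sq
    (hρ : ρ ^ 3 + ((a : K) - 1) * ρ ^ 2 - (a : K) * ρ - 1 = 0) :
    IsTotPosUnit (Algebra.adjoin ℤ {ρ}) (ρ ^ 2) := by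
  refine ⟨pow_mem self_mem _, ?_, fun σ => ?_⟩
  · rw [← inv_pow, (inv_eq_of_cubic hρ).1]
    refine pow_mem ?_ _
    have := coords_mem (ρ := ρ) (-a) (a - 1) 1
    push_cast at this
    convert this using 1
    ring
  · rw [map_pow]
    have : σ ρ ≠ 0 := (map_ne_zero σ).2 (ne_zero_of_cubic hρ)
    positivity

theorem isTotPosUnit_sq_sub (ha : 3 ≤ a)
    (hρ : ρ ^ 3 + ((a : K) - 1) * ρ ^ 2 - (a : K) * ρ - 1 = 0) :
    IsTotPosUnit (Algebra.adjoin ℤ {ρ}) (ρ ^ 2 - ρ) := by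
  refine ⟨sub_mem (pow_mem self_mem _) self_mem, ?_, fun σ => ?_⟩
  · rw [(inv_eq_of_cubic hρ).2]
    exact add_mem self_mem (intCast_mem _ _)
  · have h := cubic_map hρ σ
    have h1 := (root_cases (a := (a : ℝ)) (by exact_mod_cast ha) h).1
    have h2 : 0 < σ ρ * (σ ρ - 1) := pos_of_mul_pos_left (h.symm ▸ one_pos) h1.le
    rw [map_sub, map_pow]
    linarith

/-- No totally positive unit can be split off a totally positive unit multiple of an indecomposable
element that is not a unit. -/
theorem not_totallyPositive_sub_unit {O : Subalgebra ℤ K} {α : O}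
    (hα : IndecomposableInOrder O α) (hunit : ¬ IsUnit α) {v u : K} (hv0 : v ≠ 0) (hu0 : u ≠ 0)
    (hv : IsTotPosUnit O v) (hu : IsTotPosUnit O u) :
    α * v ≠ u ∧ ¬ TotallyPositive (α * v - u) := by
  constructor
  · intro h
    refine hunit (IsUnit.of_mul_eq_one ⟨v * u⁻¹, mul_mem hv.1 hu.2.1⟩ (Subtype.ext ?_))
    push_cast
    rw [← mul_assoc, h, mul_inv_cancel₀ hu0]
  · intro h
    refine hα.2 ⟨⟨u * v⁻¹, mul_mem hu.1 hv.2.1⟩, ⟨(α * v - u) * v⁻¹,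
      mul_mem (sub_mem (mul_mem α.2 hv.1) hu.1) hv.2.1⟩, hu.2.2.mul hv.2.2.inv,
      h.mul hv.2.2.inv, ?_⟩
    apply Subtype.ext
    push_cast
    field_simp
    ring

theorem totallyPositive_combination [CharZero K] {p q w : K} (hp : TotallyPositive p)
    (hq : TotallyPositive q) (hw : TotallyPositive w) {r s t : ℚ} (hr : 0 ≤ r) (hs : 0 ≤ s)
    (ht : 0 ≤ t) (h : r ≠ 0 ∨ s ≠ 0 ∨ t ≠ 0) : TotallyPositive (r * p + s * q + t * w) := by
  intro σ
  have hr' : (0:ℝ) ≤ r := by exact_mod_cast hr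
  have hs' : (0:ℝ) ≤ s := by exact_mod_cast hs
  have ht' : (0:ℝ) ≤ t := by exact_mod_cast ht
  have h1 := mul_nonneg hr' (hp σ).le
  have h2 := mul_nonneg hs' (hq σ).le
  have h3 := mul_nonneg ht' (hw σ).le
  simp only [map_add, map_mul, map_ratCast]
  rcases h with h | h | h
  · have := mul_pos (lt_of_le_of_ne hr' (by exact_mod_cast h.symm)) (hp σ)
    linarith
  · have := mul_pos (lt_of_le_of_ne hs' (by exact_mod_cast h.symm)) (hq σ)
    linarith
  · have := mul_pos (lt_of_le_of_ne ht' (by exact_mod_cast h.symm)) (hw σ)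
    linarith

/-- An indecomposable element that is not a unit has all coordinates less than `1` in a simplicial
cone spanned by totally positive units. -/
theorem coeff_lt_one [CharZero K] {O : Subalgebra ℤ K} {α : O}
    (hα : IndecomposableInOrder O α) (hunit : ¬ IsUnit α) {v p q w : K} (hv0 : v ≠ 0)
    (hp0 : p ≠ 0) (hv : IsTotPosUnit O v) (hp : IsTotPosUnit O p) (hq : TotallyPositive q)
    (hw : TotallyPositive w) {r s t : ℚ} (hs : 0 ≤ s) (ht : 0 ≤ t)
    (h : α * v = r * p + s * q + t * w) : r < 1 := by
  by_contra! hr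
  obtain ⟨h1, h2⟩ := not_totallyPositive_sub_unit hα hunit hv0 hp0 hv hp
  have e : α * v - p = ((r - 1 : ℚ) : K) * p + s * q + t * w := by
    rw [h]; push_cast; ring
  by_cases hz : r - 1 ≠ 0 ∨ s ≠ 0 ∨ t ≠ 0
  · apply h2
    rw [e]
    exact totallyPositive_combination hp.2.2 hq hw (by linarith) hs ht hz
  · push Not at hz
    apply h1
    rw [← sub_eq_zero, e, hz.1, hz.2.1, hz.2.2]
    simp

end

/-! ### Traces against the dual elements -/

section
variable {K : Type*} [Field K] [NumberField K] {a : ℤ} {ρ : K}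

theorem trace_coords_div (ha : 3 ≤ a)
    (hρ : ρ ^ 3 + ((a : K) - 1) * ρ ^ 2 - (a : K) * ρ - 1 = 0)
    (hK : IntermediateField.adjoin ℚ {ρ} = ⊤) (A B C : ℚ) :
    Algebra.trace ℚ K ((A + B * ρ + C * ρ ^ 2) / (3 * ρ ^ 2 + 2 * (a - 1) * ρ - a)) = C := by
  set D : K := 3 * ρ ^ 2 + 2 * (a - 1) * ρ - a with hD
  have e : (A + B * ρ + C * ρ ^ 2) / D = A • (ρ ^ 0 / D) + B • (ρ ^ 1 / D) + C • (ρ ^ 2 / D) := by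
    simp only [Algebra.smul_def, eq_ratCast]
    ring
  rw [e, map_add, map_add, map_smul, map_smul, map_smul, hD,
    trace_pow_div ha hρ hK (by norm_num), trace_pow_div ha hρ hK (by norm_num),
    trace_pow_div ha hρ hK (by norm_num)]
  simp

theorem trace_mul_dualOne (ha : 3 ≤ a)
    (hρ : ρ ^ 3 + ((a : K) - 1) * ρ ^ 2 - (a : K) * ρ - 1 = 0)
    (hK : IntermediateField.adjoin ℚ {ρ} = ⊤) {x : K} (A B C : ℚ)
    (hx : x = A + B * ρ + C * ρ ^ 2) :
    Algebra.trace ℚ K (x * dualOne a ρ) = A + C := by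
  rw [← trace_coords_div ha hρ hK (A + B - a * A) (B + C + (a - 1) * A) (A + C), dualOne, hx,
    ← mul_div_assoc]
  congr 2
  push_cast
  linear_combination (B + C * ρ : K) * hρ

theorem trace_mul_dualTwo (ha : 3 ≤ a)
    (hρ : ρ ^ 3 + ((a : K) - 1) * ρ ^ 2 - (a : K) * ρ - 1 = 0)
    (hK : IntermediateField.adjoin ℚ {ρ} = ⊤) {x : K} (A B C : ℚ)
    (hx : x = A + B * ρ + C * ρ ^ 2) :
    Algebra.trace ℚ K (x * dualTwo a ρ) = A + (1 - a) * B + (a ^ 2 - a + 1 - 1 / a) * C := by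
  rw [← trace_coords_div ha hρ hK (B - (a - 1) * C - A / a)
    (a * B + (1 - a * (a - 1)) * C - B / a)
    (A + (1 - a) * B + (a ^ 2 - a + 1 - 1 / a) * C), dualTwo, hx, ← mul_div_assoc]
  congr 2
  push_cast
  linear_combination (B + C * (ρ + (1 - a)) : K) * hρ
end

/-! ### Reduction to a cone by minimising a trace -/

section
variable {K : Type*} [Field K] [NumberField K] {a : ℤ} {ρ : K}

theorem exists_nat_trace_dual (ha : 3 ≤ a)
    (hρ : ρ ^ 3 + ((a : K) - 1) * ρ ^ 2 - (a : K) * ρ - 1 = 0)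
    (hK : IntermediateField.adjoin ℚ {ρ} = ⊤) {x : K} (hx : x ∈ Algebra.adjoin ℤ {ρ})
    (hpos : TotallyPositive x) {d : K} (hd : d = dualOne a ρ ∨ d = dualTwo a ρ) :
    ∃ n : ℕ, a * Algebra.trace ℚ K (x * d) = n := by
  have haq : (a : ℚ) ≠ 0 := by exact_mod_cast (show a ≠ 0 by omega)
  have hdp : TotallyPositive d := by
    rcases hd with rfl | rfl
    exacts [(totallyPositive_dual ha hρ).1, (totallyPositive_dual ha hρ).2]
  obtain ⟨A, B, C, hx⟩ := exists_coords hρ hx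
  have hx' : x = ((A : ℚ) : K) + ((B : ℚ) : K) * ρ + ((C : ℚ) : K) * ρ ^ 2 := by
    rw [hx]; push_cast; ring
  have hint : ∃ n : ℤ, a * Algebra.trace ℚ K (x * d) = n := by
    rcases hd with rfl | rfl
    · refine ⟨a * (A + C), ?_⟩
      rw [trace_mul_dualOne ha hρ hK A B C hx']
      push_cast
      ring
    · refine ⟨a * (A + (1 - a) * B + (a ^ 2 - a + 1) * C) - C, ?_⟩
      rw [trace_mul_dualTwo ha hρ hK A B C hx']
      push_cast
      field_simp
      ring
  obtain ⟨n, hn⟩ := hint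
  have h0 : (0 : ℚ) ≤ n := by
    rw [← hn]
    exact mul_nonneg (by exact_mod_cast (show 0 ≤ a by omega))
      ((hpos.mul hdp).trace_pos ha hρ hK).le
  lift n to ℕ using by exact_mod_cast h0
  exact ⟨n, by rw [hn]; simp⟩

/-- Among the traces of `α v` against the two dual elements, with `v` a totally positive unit, there
is a smallest one, since they are positive rational numbers with denominator dividing `a`. -/
theorem exists_minimal_trace (ha : 3 ≤ a)
    (hρ : ρ ^ 3 + ((a : K) - 1) * ρ ^ 2 - (a : K) * ρ - 1 = 0)
    (hK : IntermediateField.adjoin ℚ {ρ} = ⊤) {α : K} (hα : α ∈ Algebra.adjoin ℤ {ρ})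
    (hpos : TotallyPositive α) :
    ∃ v d : K, IsTotPosUnit (Algebra.adjoin ℤ {ρ}) v ∧ (d = dualOne a ρ ∨ d = dualTwo a ρ) ∧
      ∀ w d' : K, IsTotPosUnit (Algebra.adjoin ℤ {ρ}) w → (d' = dualOne a ρ ∨ d' = dualTwo a ρ) →
        Algebra.trace ℚ K (α * v * d) ≤ Algebra.trace ℚ K (α * v * w * d') := by
  classical
  have haq : (0 : ℚ) < a := by exact_mod_cast (show 0 < a by omega)
  have hex : ∃ n : ℕ, ∃ v d : K, IsTotPosUnit (Algebra.adjoin ℤ {ρ}) v ∧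
      (d = dualOne a ρ ∨ d = dualTwo a ρ) ∧ a * Algebra.trace ℚ K (α * v * d) = n := by
    obtain ⟨n, hn⟩ := exists_nat_trace_dual ha hρ hK hα hpos (Or.inl rfl)
    exact ⟨n, 1, _, isTotPosUnit_one _, Or.inl rfl, by rw [mul_one]; exact hn⟩
  obtain ⟨v, d, hv, hd, hn⟩ := Nat.find_spec hex
  refine ⟨v, d, hv, hd, fun w d' hw hd' => ?_⟩
  have hvw := hv.mul hw
  obtain ⟨m, hm⟩ := exists_nat_trace_dual ha hρ hK (mul_mem hα hvw.1) (hpos.mul hvw.2.2) hd'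
  have hle := Nat.find_min' hex ⟨v * w, d', hvw, hd', hm⟩
  refine le_of_mul_le_mul_left ?_ haq
  rw [hn, mul_assoc α v w, hm]
  exact_mod_cast hle

/-- If `dualOne` minimises the trace of `x`, then `x` lies in the cone spanned by `1`, `ρ ^ 2` and
`ρ ^ 2 - ρ`: the three inequalities come from the dual elements of the three adjacent cones. -/
theorem mem_cone_one (ha : 3 ≤ a)
    (hρ : ρ ^ 3 + ((a : K) - 1) * ρ ^ 2 - (a : K) * ρ - 1 = 0)
    (hK : IntermediateField.adjoin ℚ {ρ} = ⊤) {x : K} {A B C : ℚ}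
    (hx : x = A + B * ρ + C * ρ ^ 2)
    (hmin : ∀ w : K, IsTotPosUnit (Algebra.adjoin ℤ {ρ}) w →
      Algebra.trace ℚ K (x * dualOne a ρ) ≤ Algebra.trace ℚ K (x * w * dualTwo a ρ)) :
    0 ≤ A ∧ 0 ≤ B + C ∧ 0 ≤ -B := by
  have hε := isTotPosUnit_sq hρ
  have hη := isTotPosUnit_sq_sub ha hρ
  have haq : (3 : ℚ) ≤ a := by exact_mod_cast ha
  have hq : 1 / (a : ℚ) ≤ 1 / 3 := one_div_le_one_div_of_le (by norm_num) haq
  have hq0 : 0 < 1 / (a : ℚ) := one_div_pos.2 (by linarith)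
  have hqa : (a : ℚ) * (1 / a) = 1 := mul_one_div_cancel (by linarith)
  obtain ⟨i1, i2⟩ := inv_eq_of_cubic hρ
  have m1 := hmin _ hη.inv
  have m2 := hmin _ hε.inv
  have m3 := hmin _ (hε.inv.mul hη.inv)
  have c1 : x * (ρ ^ 2 - ρ)⁻¹ = ((C + a * A : ℚ) : K) + ((A + a * C + a * B : ℚ) : K) * ρ
      + ((B + C : ℚ) : K) * ρ ^ 2 := by
    rw [i2, hx]; push_cast; linear_combination (C : K) * hρ
  have cρ : x * ρ⁻¹ = ((B - a * A : ℚ) : K) + ((C + (a - 1) * A : ℚ) : K) * ρ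
      + ((A : ℚ) : K) * ρ ^ 2 := by
    rw [i1, hx]; push_cast; linear_combination (B + C * ρ : K) * hρ
  have c2 : x * (ρ ^ 2)⁻¹ = ((C + (a - 1) * A - a * (B - a * A) : ℚ) : K)
      + ((A + (a - 1) * (B - a * A) : ℚ) : K) * ρ + ((B - a * A : ℚ) : K) * ρ ^ 2 := by
    have : x * (ρ ^ 2)⁻¹ = x * ρ⁻¹ * ρ⁻¹ := by rw [sq, mul_inv, mul_assoc]
    rw [this, cρ, i1]; push_cast
    linear_combination ((C + (a - 1) * A) + A * ρ : K) * hρ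
  have c3 : x * ((ρ ^ 2)⁻¹ * (ρ ^ 2 - ρ)⁻¹) =
      ((B - a * A + a * (C + (a - 1) * A - a * (B - a * A)) : ℚ) : K)
      + ((C + (a - 1) * A - a * (B - a * A) + a * (B - a * A)
        + a * (A + (a - 1) * (B - a * A)) : ℚ) : K) * ρ
      + ((A + (a - 1) * (B - a * A) + (B - a * A) : ℚ) : K) * ρ ^ 2 := by
    rw [← mul_assoc, c2, i2]; push_cast
    linear_combination (B - a * A : K) * hρ
  rw [trace_mul_dualOne ha hρ hK A B C hx, trace_mul_dualTwo ha hρ hK _ _ _ c1] at m1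
  rw [trace_mul_dualOne ha hρ hK A B C hx, trace_mul_dualTwo ha hρ hK _ _ _ c2] at m2
  rw [trace_mul_dualOne ha hρ hK A B C hx, trace_mul_dualTwo ha hρ hK _ _ _ c3] at m3
  clear c1 cρ c2 c3
  generalize 1 / (a : ℚ) = q at hq hq0 hqa m1 m2 m3
  generalize (a : ℚ) = b at haq hqa m1 m2 m3
  -- each left factor is the excess over `1` of the adjacent functional at the opposite generator
  refine ⟨?_, ?_, ?_⟩
  · refine (mul_nonneg_iff_of_pos_left (show 0 < b - 1 - q by linarith)).1 ?_
    linear_combination m3 + (A * b - B) * hqa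
  · refine (mul_nonneg_iff_of_pos_left (show 0 < 1 - q by linarith)).1 ?_
    linear_combination m1
  · refine (mul_nonneg_iff_of_pos_left hq0).1 ?_
    linear_combination m2 + A * hqa

theorem coords_mul_self (hρ : ρ ^ 3 + ((a : K) - 1) * ρ ^ 2 - (a : K) * ρ - 1 = 0) {x : K}
    {A B C : ℚ} (hx : x = A + B * ρ + C * ρ ^ 2) :
    x * ρ = (C : ℚ) + ((A + a * C : ℚ) : K) * ρ + ((B - (a - 1) * C : ℚ) : K) * ρ ^ 2 := by
  rw [hx]; push_cast; linear_combination (C : K) * hρ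

/-- If `dualTwo` minimises the trace of `x`, then `x` lies in the cone spanned by `1`, `ρ + a` and
`ρ⁻¹ ^ 2`: the three inequalities come from the dual elements of the three adjacent cones. -/
theorem mem_cone_two (ha : 3 ≤ a)
    (hρ : ρ ^ 3 + ((a : K) - 1) * ρ ^ 2 - (a : K) * ρ - 1 = 0)
    (hK : IntermediateField.adjoin ℚ {ρ} = ⊤) {x : K} {A B C : ℚ}
    (hx : x = A + B * ρ + C * ρ ^ 2)
    (hmin : ∀ w : K, IsTotPosUnit (Algebra.adjoin ℤ {ρ}) w →
      Algebra.trace ℚ K (x * dualTwo a ρ) ≤ Algebra.trace ℚ K (x * w * dualOne a ρ)) :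
    0 ≤ A - a * B + (a ^ 2 - 1 / a) * C ∧ 0 ≤ B + (1 - a + 1 / a) * C ∧ 0 ≤ -(1 / a) * C := by
  have hε := isTotPosUnit_sq hρ
  have hη := isTotPosUnit_sq_sub ha hρ
  have haq : (3 : ℚ) ≤ a := by exact_mod_cast ha
  have hq : 1 / (a : ℚ) ≤ 1 / 3 := one_div_le_one_div_of_le (by norm_num) haq
  have hq0 : 0 < 1 / (a : ℚ) := one_div_pos.2 (by linarith)
  have hqa : (a : ℚ) * (1 / a) = 1 := mul_one_div_cancel (by linarith)
  have m1 := hmin _ hη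
  have m2 := hmin _ hε
  have m3 := hmin _ (hε.mul hη)
  have c1 := coords_mul_self hρ hx
  have c2 := coords_mul_self hρ c1
  have c3 := coords_mul_self hρ c2
  have c4 := coords_mul_self hρ c3
  rw [show x * (ρ ^ 2 - ρ) * dualOne a ρ = x * ρ * ρ * dualOne a ρ - x * ρ * dualOne a ρ by ring,
    map_sub, trace_mul_dualTwo ha hρ hK _ _ _ hx, trace_mul_dualOne ha hρ hK _ _ _ c2,
    trace_mul_dualOne ha hρ hK _ _ _ c1] at m1
  rw [show x * ρ ^ 2 * dualOne a ρ = x * ρ * ρ * dualOne a ρ by ring,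
    trace_mul_dualTwo ha hρ hK _ _ _ hx, trace_mul_dualOne ha hρ hK _ _ _ c2] at m2
  rw [show x * (ρ ^ 2 * (ρ ^ 2 - ρ)) * dualOne a ρ =
      x * ρ * ρ * ρ * ρ * dualOne a ρ - x * ρ * ρ * ρ * dualOne a ρ by ring,
    map_sub, trace_mul_dualTwo ha hρ hK _ _ _ hx, trace_mul_dualOne ha hρ hK _ _ _ c4,
    trace_mul_dualOne ha hρ hK _ _ _ c3] at m3
  clear c1 c2 c3 c4
  generalize 1 / (a : ℚ) = q at hq hq0 hqa m1 m2 m3 ⊢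
  generalize (a : ℚ) = b at haq hqa m1 m2 m3 ⊢
  -- each left factor is the excess over `1` of the adjacent functional at the opposite generator
  refine ⟨?_, ?_, ?_⟩
  · refine (mul_nonneg_iff_of_pos_left (show 0 < b ^ 2 - b - 1 by nlinarith)).1 ?_
    linear_combination m3 + (b - 1) * C * hqa
  · linear_combination m2
  · refine (mul_nonneg_iff_of_pos_left (show 0 < b - 1 by linarith)).1 ?_
    linear_combination m1 + C * hqa
end

/-! ### Normal form of the indecomposable elements and the minimal trace -/

section
variable {K : Type*} [Field K] [NumberField K] {a : ℤ} {ρ : K}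

/-- Up to a totally positive unit, an indecomposable element that is not a unit is
`t + (1 - t) (ρ + a) + t ρ⁻²` with `0 < t < 1`. -/
theorem exists_normal_form (ha : 3 ≤ a)
    (hρ : ρ ^ 3 + ((a : K) - 1) * ρ ^ 2 - (a : K) * ρ - 1 = 0)
    (hK : IntermediateField.adjoin ℚ {ρ} = ⊤)
    {α : Algebra.adjoin ℤ {ρ}} (hα : IndecomposableInOrder (Algebra.adjoin ℤ {ρ}) α)
    (hunit : ¬ IsUnit α) :
    ∃ (v : K) (t : ℚ), IsTotPosUnit (Algebra.adjoin ℤ {ρ}) v ∧ 0 < t ∧ t < 1 ∧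
      α * v = t * 1 + (1 - t : ℚ) * (ρ ^ 2 - ρ)⁻¹ + t * (ρ ^ 2)⁻¹ := by
  have hε := isTotPosUnit_sq hρ
  have hη := isTotPosUnit_sq_sub ha hρ
  have h1 := isTotPosUnit_one (Algebra.adjoin ℤ {ρ})
  have haq : (3 : ℚ) ≤ a := by exact_mod_cast ha
  obtain ⟨v, d, hv, hd, hmin⟩ := exists_minimal_trace ha hρ hK α.2 hα.1
  have hv0 : v ≠ 0 := hv.2.2.ne_zero ha hρ hK
  have hε0 : ρ ^ 2 ≠ 0 := hε.2.2.ne_zero ha hρ hK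
  have hη0 : ρ ^ 2 - ρ ≠ 0 := hη.2.2.ne_zero ha hρ hK
  have hx0 : (α : K) * v ≠ 0 := (hα.1.mul hv.2.2).ne_zero ha hρ hK
  obtain ⟨A, B, C, hx⟩ := exists_coords hρ (mul_mem α.2 hv.1)
  have hx' : α * v = ((A : ℚ) : K) + ((B : ℚ) : K) * ρ + ((C : ℚ) : K) * ρ ^ 2 := by
    rw [hx]; push_cast; ring
  rcases hd with rfl | rfl
  · exfalso
    obtain ⟨p1, p2, p3⟩ := mem_cone_one ha hρ hK hx' fun w hw => hmin w _ hw (Or.inr rfl)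
    have e : α * v = ((A : ℚ) : K) * 1 + ((B + C : ℚ) : K) * ρ ^ 2 +
        ((-B : ℚ) : K) * (ρ ^ 2 - ρ) := by
      rw [hx']; push_cast; ring
    have l1 := coeff_lt_one hα hunit hv0 one_ne_zero hv h1 hε.2.2 hη.2.2 p2 p3 e
    have l2 := coeff_lt_one hα hunit hv0 hε0 hv hε hη.2.2 h1.2.2 p3 p1
      (e.trans ((add_assoc _ _ _).trans (add_comm _ _)))
    have l3 := coeff_lt_one hα hunit hv0 hη0 hv hη h1.2.2 hε.2.2 p1 p2
      (e.trans ((add_comm _ _).trans (add_assoc _ _ _).symm))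
    norm_cast at p1 p2 p3 l1 l2 l3
    have hA : A = 0 := by omega
    have hB : B = 0 := by omega
    have hC : C = 0 := by omega
    exact hx0 (by rw [hx, hA, hB, hC]; simp)
  · obtain ⟨p1, p2, p3⟩ := mem_cone_two ha hρ hK hx' fun w hw => hmin w _ hw (Or.inl rfl)
    have hqa : (a : ℚ) * (1 / a) = 1 := mul_one_div_cancel (by linarith)
    have hqaK : (a : K) * ((1 / a : ℚ) : K) = 1 := by
      have := congrArg (fun q : ℚ => (q : K)) hqa
      simpa only [Rat.cast_mul, Rat.cast_intCast, Rat.cast_one] using this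
    set q : ℚ := 1 / a
    obtain ⟨i1, i2⟩ := inv_eq_of_cubic hρ
    have i3 : (ρ ^ 2)⁻¹ = -a * ρ ^ 2 + (1 + a - a ^ 2) * ρ + (a ^ 2 + a - 1) := by
      rw [← inv_pow, i1]
      linear_combination (ρ + (a - 1) : K) * hρ
    have e : α * v = ((A - a * B + (a ^ 2 - q) * C : ℚ) : K) * 1 +
        ((B + (1 - a + q) * C : ℚ) : K) * (ρ ^ 2 - ρ)⁻¹ +
        ((-q * C : ℚ) : K) * (ρ ^ 2)⁻¹ := by
      rw [hx', i2, i3]; push_cast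
      linear_combination (-C * (ρ ^ 2 + (a - 1) * ρ - a) : K) * hqaK
    have l1 := coeff_lt_one hα hunit hv0 one_ne_zero hv h1 hη.inv.2.2 hε.inv.2.2 p2 p3 e
    have l2 := coeff_lt_one hα hunit hv0 (inv_ne_zero hη0) hv hη.inv hε.inv.2.2 h1.2.2 p3 p1
      (e.trans ((add_assoc _ _ _).trans (add_comm _ _)))
    have l3 := coeff_lt_one hα hunit hv0 (inv_ne_zero hε0) hv hε.inv h1.2.2 hη.inv.2.2 p1 p2
      (e.trans ((add_comm _ _).trans (add_assoc _ _ _).symm))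
    -- With `r`, `s`, `t` the coordinates, `r - t` is an integer in `(-1, 1)` and `s + t` is an
    -- integer in `[0, 2)`.
    have hm : A - a * B + a ^ 2 * C = 0 := by
      have g1 : ((A - a * B + a ^ 2 * C : ℤ) : ℚ) < 1 := by push_cast; linarith
      have g2 : (-1 : ℚ) < ((A - a * B + a ^ 2 * C : ℤ) : ℚ) := by push_cast; linarith
      have g1' : A - a * B + a ^ 2 * C < 1 := by exact_mod_cast g1
      have g2' : -1 < A - a * B + a ^ 2 * C := by exact_mod_cast g2
      omega
    have hmq : (A - a * B + a ^ 2 * C : ℚ) = 0 := by exact_mod_cast hm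
    have hr : (A - a * B + (a ^ 2 - q) * C : ℚ) = -q * C := by linear_combination hmq
    have g1 : ((B + (1 - a) * C : ℤ) : ℚ) < 2 := by push_cast; linarith
    have g2 : (0 : ℚ) ≤ ((B + (1 - a) * C : ℤ) : ℚ) := by push_cast; linarith
    have g1' : B + (1 - a) * C < 2 := by exact_mod_cast g1
    have g2' : 0 ≤ B + (1 - a) * C := by exact_mod_cast g2
    have hcase : B + (1 - a) * C = 0 ∨ B + (1 - a) * C = 1 := by omega
    rcases hcase with hn | hn
    · exfalso
      have hnq : (B + (1 - a) * C : ℚ) = 0 := by exact_mod_cast hn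
      have ht : -q * C = 0 := by linarith
      have hs : B + (1 - a + q) * C = 0 := by linarith
      apply hx0
      rw [e, hr, hs, ht]
      simp
    · have hnq : (B + (1 - a) * C : ℚ) = 1 := by exact_mod_cast hn
      have hs : B + (1 - a + q) * C = 1 - -q * C := by linear_combination hnq
      rw [hs] at l2
      rw [hr, hs] at e
      exact ⟨v, -q * C, hv, by linarith, l3, e⟩

theorem exists_int_trace_mul_dualOne (ha : 3 ≤ a)
    (hρ : ρ ^ 3 + ((a : K) - 1) * ρ ^ 2 - (a : K) * ρ - 1 = 0)
    (hK : IntermediateField.adjoin ℚ {ρ} = ⊤) {x : K} (hx : x ∈ Algebra.adjoin ℤ {ρ}) :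
    ∃ n : ℤ, Algebra.trace ℚ K (x * dualOne a ρ) = n := by
  obtain ⟨A, B, C, hx⟩ := exists_coords hρ hx
  exact ⟨A + C, by
    rw [trace_mul_dualOne ha hρ hK A B C (by rw [hx]; push_cast; ring)]; push_cast; rfl⟩

theorem one_le_trace_unit_mul (ha : 3 ≤ a)
    (hρ : ρ ^ 3 + ((a : K) - 1) * ρ ^ 2 - (a : K) * ρ - 1 = 0)
    (hK : IntermediateField.adjoin ℚ {ρ} = ⊤) {u δ : K}
    (hu : IsTotPosUnit (Algebra.adjoin ℤ {ρ}) u) (hδ : δ ∈ codifferent (Algebra.adjoin ℤ {ρ}))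
    (hpos : TotallyPositive δ) : 1 ≤ Algebra.trace ℚ K (u * δ) := by
  obtain ⟨n, hn⟩ := (mem_codifferent_iff _ δ).1 hδ u hu.1
  have h := (hu.2.2.mul hpos).trace_pos ha hρ hK
  rw [hn] at h ⊢
  have h' : 0 < n := by exact_mod_cast h
  exact_mod_cast h'

end

theorem mainTheorem5 {K : Type*} [Field K] [NumberField K] (a : ℤ) (ha : 3 ≤ a) (ρ : K)
    (hρ : ρ ^ 3 + ((a : K) - 1) * ρ ^ 2 - (a : K) * ρ - 1 = 0)
    (hK : IntermediateField.adjoin ℚ {ρ} = ⊤)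
    (α : Algebra.adjoin ℤ {ρ}) (hα : IndecomposableInOrder (Algebra.adjoin ℤ {ρ}) α)
    (hunit : ¬ IsUnit α) :
    IsLeast {t : ℚ | ∃ δ : K, δ ∈ codifferent (Algebra.adjoin ℤ {ρ}) ∧ TotallyPositive δ ∧
      Algebra.trace ℚ K ((α : K) * δ) = t} 2 := by
  obtain ⟨v, t, hv, ht0, ht1, h⟩ := exists_normal_form ha hρ hK hα hunit
  have hε := isTotPosUnit_sq hρ
  have hη := isTotPosUnit_sq_sub ha hρ
  have hρ0 := ne_zero_of_cubic hρ
  have hv0 : v ≠ 0 := hv.2.2.ne_zero ha hρ hK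
  constructor
  · refine ⟨v * ρ ^ 2 * dualOne a ρ, ?_,
      (hv.2.2.mul hε.2.2).mul (totallyPositive_dual ha hρ).1, ?_⟩
    · rw [mem_codifferent_iff]
      intro β hβ
      rw [← mul_assoc]
      exact exists_int_trace_mul_dualOne ha hρ hK (mul_mem hβ (hv.mul hε).1)
    · have e : α * (v * ρ ^ 2 * dualOne a ρ) = (((1 : ℚ) : K) + ((a * (1 - t) : ℚ) : K) * ρ
          + ((1 : ℚ) : K) * ρ ^ 2) * dualOne a ρ := by
        have hεinv : (ρ ^ 2)⁻¹ * ρ ^ 2 = 1 := inv_mul_cancel₀ (pow_ne_zero 2 hρ0)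
        rw [← mul_assoc, ← mul_assoc, h, (inv_eq_of_cubic hρ).2]
        push_cast
        linear_combination (((1 - t) * hρ + t * hεinv) * dualOne a ρ)
      rw [e, trace_mul_dualOne ha hρ hK _ _ _ rfl]
      norm_num
  · rintro _ ⟨δ, hδ, hpos, rfl⟩
    obtain ⟨n, hn⟩ := (mem_codifferent_iff _ δ).1 hδ α α.2
    have e : α * δ = t • (1 * v⁻¹ * δ) + (1 - t) • ((ρ ^ 2 - ρ)⁻¹ * v⁻¹ * δ)
        + t • ((ρ ^ 2)⁻¹ * v⁻¹ * δ) := by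
      rw [(eq_mul_inv_iff_mul_eq₀ hv0).2 h]
      simp only [Algebra.smul_def, eq_ratCast]
      ring
    have b1 := one_le_trace_unit_mul ha hρ hK ((isTotPosUnit_one _).mul hv.inv) hδ hpos
    have b2 := one_le_trace_unit_mul ha hρ hK (hη.inv.mul hv.inv) hδ hpos
    have b3 := one_le_trace_unit_mul ha hρ hK (hε.inv.mul hv.inv) hδ hpos
    have hgt : 1 < Algebra.trace ℚ K (α * δ) := by
      rw [e, map_add, map_add, map_smul, map_smul, map_smul, smul_eq_mul, smul_eq_mul, smul_eq_mul]
      nlinarith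
    rw [hn] at hgt ⊢
    have h' : 1 < n := by exact_mod_cast hgt
    exact_mod_cast h'
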